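/- Let $X=\{0,1\}^{\mathbb N}$ with its Borel $\sigma$-algebra. Given a probability distribution $\lambda$ on $\{0,1\}$ and a sequence $\boldsymbol P=(P^{(n)})_{n\ge1}$ of stochastic $2\times2$ matrices $P^{(n)}=(P^{(n)}_{i,j})_{i,j\in\{0,1\}}$, the Markov measure determined by $(\lambda,\boldsymbol P)$ is the Borel probability measure $\mu$ on $X$ with $$\mu(\{x\in X: x_1=a_1,\dots,x_k=a_k\})=\lambda(a_1)P^{(1)}_{a_1,a_2}P^{(2)}_{a_2,a_3}\cdots P^{(k-1)}_{a_{k-1},a_k}$$ for all $k\ge1$ and $a_1,\dots,a_k\in\{0,1\}$. It is called non-degenerate if $\lambda(a)>0$ and $P^{(n)}_{a,b}>0$ for all $a,b\in\{0,1\}$ and $n\ge1$, and non-atomic if $\mu(\{x\})=0$ for every $x\in X$. Two measures are equivalent if each is absolutely continuous with respect to the other. Let $\mu$ and $\nu$ be two non-degenerate and non-atomic Markov measures on $X$ determined by pairs $(\lambda,\boldsymbol P)$ and $(\kappa,\boldsymbol Q)$ respectively. 1. The limit $$L=\lim_{n\to\infty}\ \sum_{a_1,\dots,a_n=0}^1\sqrt{\kappa(a_1)\lambda(a_1)}\,\prod_{i=1}^{n-1}\sqrt{Q^{(i)}_{a_i,a_{i+1}}P^{(i)}_{a_i,a_{i+1}}}$$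 exists, and $\nu$ is equivalent to $\mu$ if and only if $L\ne0$. 2. If $\nu$ is equivalent to $\mu$, then for $\mu$-almost every $x\in X$ $$\frac{d\nu}{d\mu}(x)=\frac{\kappa(x_1)}{\lambda(x_1)}\prod_{j=1}^{\infty}\frac{Q^{(j)}_{x_j,x_{j+1}}}{P^{(j)}_{x_j,x_{j+1}}},$$ where the infinite product is the limit of its partial products, which exists for $\mu$-almost every $x$. 3. If $\inf_{n\ge1}\min_{i,j}P^{(n)}_{i,j}>0$ and $\inf_{n\ge1}\min_{i,j}Q^{(n)}_{i,j}>0$, then $\mu$ and $\nu$ are equivalent if and only if $\sum_{n=1}^\infty\bigl(P^{(n)}_{i,j}-Q^{(n)}_{i,j}\bigr)^2<\infty$ for all $i,j\in\{0,1\}$. -/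

import Mathlib

open MeasureTheory ProbabilityTheory Filter Topology

/-- A pair `(λ, P)`: a distribution `λ` on `{0,1}` and a sequence of stochastic `2 × 2` matrices.
Times are counted from `0`, so `trans n` is the matrix `P⁽ⁿ⁺¹⁾` of the usual one-based notation and
governs the transition from the coordinate `x n` to the coordinate `x (n + 1)`. -/
structure MarkovPair where
  init : Fin 2 → ℝ
  init_mem : init ∈ stdSimplex ℝ (Fin 2)
  trans : ℕ → Matrix (Fin 2) (Fin 2) ℝ
  trans_mem : ∀ n, trans n ∈ Matrix.rowStochastic ℝ (Fin 2)

/-- The measure on `{0,1}` that gives the point `a` the mass `p a`. -/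
noncomputable def weightMeasure (p : Fin 2 → ℝ) : Measure (Fin 2) :=
  ∑ a, ENNReal.ofReal (p a) • Measure.dirac a

theorem weightMeasure_singleton (p : Fin 2 → ℝ) (a : Fin 2) :
    weightMeasure p {a} = ENNReal.ofReal (p a) := by
  fin_cases a <;> simp [weightMeasure]

theorem weightMeasure_isProbability {p : Fin 2 → ℝ} (hp : p ∈ stdSimplex ℝ (Fin 2)) :
    IsProbabilityMeasure (weightMeasure p) := by
  constructor
  have h : ∑ a, ENNReal.ofReal (p a) = 1 := by
    rw [← ENNReal.ofReal_sum_of_nonneg fun a _ => hp.1 a, hp.2, ENNReal.ofReal_one]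
  simpa [weightMeasure] using h

namespace MarkovPair

theorem trans_row_mem (M : MarkovPair) (n : ℕ) (a : Fin 2) :
    (fun b => M.trans n a b) ∈ stdSimplex ℝ (Fin 2) :=
  ⟨fun _ => Matrix.nonneg_of_mem_rowStochastic (M.trans_mem n),
    Matrix.sum_row_of_mem_rowStochastic (M.trans_mem n) a⟩

instance (M : MarkovPair) : IsProbabilityMeasure (weightMeasure M.init) :=
  weightMeasure_isProbability M.init_mem

/-- The law of `x (n + 1)` given `x 0, …, x n`: it is the row of index `x n` of `trans n`. -/
noncomputable def stepKernel (M : MarkovPair) (n : ℕ) :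
    Kernel (Π _ : Finset.Iic n, Fin 2) (Fin 2) where
  toFun x := weightMeasure fun b => M.trans n (x ⟨n, by simp⟩) b
  measurable' := Measurable.of_discrete

instance (M : MarkovPair) (n : ℕ) : IsMarkovKernel (M.stepKernel n) :=
  ⟨fun _ => weightMeasure_isProbability (M.trans_row_mem n _)⟩

/-- The Markov measure on `X = {0,1}^ℕ` determined by the pair `(λ, P)`. -/
noncomputable def measure (M : MarkovPair) : Measure (ℕ → Fin 2) :=
  Kernel.trajMeasure (X := fun _ => Fin 2) (weightMeasure M.init) M.stepKernel

instance (M : MarkovPair) : IsProbabilityMeasure M.measure := by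
  unfold measure; infer_instance

theorem cylinder_eq (n : ℕ) (a : ℕ → Fin 2) :
    {x : ℕ → Fin 2 | ∀ i ≤ n, x i = a i} =
      Preorder.frestrictLe (π := fun _ => Fin 2) n ⁻¹' {fun i : Finset.Iic n => a i} := by
  ext x
  simp [funext_iff]

/-- The value of the Markov measure on a cylinder: `μ([a₀, …, aₙ]) = λ(a₀) ∏ᵢ P(aᵢ, aᵢ₊₁)`. -/
theorem measure_cylinder (M : MarkovPair) (n : ℕ) (a : ℕ → Fin 2) :
    M.measure {x | ∀ i ≤ n, x i = a i} =
      ENNReal.ofReal (M.init (a 0) * ∏ i ∈ Finset.range n, M.trans i (a i) (a (i + 1))) := by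
  induction n with
  | zero =>
    have hm : Measurable (Preorder.frestrictLe (π := fun _ : ℕ => Fin 2) 0) := by fun_prop
    rw [cylinder_eq, ← Measure.map_apply hm (MeasurableSet.singleton _), measure,
      Kernel.trajMeasure, Measure.map_comp _ _ hm, Kernel.traj_map_frestrictLe,
      Kernel.partialTraj_self, Measure.id_comp,
      Measure.map_apply (MeasurableEquiv.measurable _) (MeasurableSet.singleton _)]
    have : ((MeasurableEquiv.piUnique (fun _ : Finset.Iic 0 => Fin 2)).symm ⁻¹'
        {fun i : Finset.Iic 0 => a i}) = {a 0} := by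
      ext y
      simp only [Set.mem_preimage, Set.mem_singleton_iff]
      constructor
      · intro h
        exact congrFun h ⟨0, by simp⟩
      · rintro rfl
        funext ⟨i, hi⟩
        have : i = 0 := by simpa using hi
        subst this
        rfl
    simp only [Finset.range_zero, Finset.prod_empty, mul_one]
    rw [← weightMeasure_singleton]
    exact congrArg _ this
  | succ n ih =>
    have hm : Measurable (Preorder.frestrictLe (π := fun _ : ℕ => Fin 2) n) := by fun_prop
    have key := Kernel.map_frestrictLe_trajMeasure_compProd_eq_map_trajMeasure
      (X := fun _ => Fin 2) (μ₀ := weightMeasure M.init) (κ := M.stepKernel) (a := n)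
    have h2 := congrArg (fun m => m ({fun i : Finset.Iic n => a i} ×ˢ {a (n + 1)})) key
    beta_reduce at h2
    rw [Measure.compProd_apply_prod (MeasurableSet.singleton _) (MeasurableSet.singleton _),
      lintegral_singleton, Measure.map_apply hm (MeasurableSet.singleton _),
      Measure.map_apply (by fun_prop) ((MeasurableSet.singleton _).prod
        (MeasurableSet.singleton _)), ← cylinder_eq] at h2
    change _ * M.measure _ = M.measure _ at h2
    rw [ih] at h2
    have hs : {x : ℕ → Fin 2 | ∀ i ≤ n + 1, x i = a i} =
        (fun x : ℕ → Fin 2 => (Preorder.frestrictLe (π := fun _ : ℕ => Fin 2) n x, x (n + 1))) ⁻¹'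
          ({fun i : Finset.Iic n => a i} ×ˢ {a (n + 1)}) := by
      ext x
      simp only [Set.mem_ofPred_eq, Set.mem_preimage, Set.mem_prod, Set.mem_singleton_iff,
        funext_iff, Preorder.frestrictLe_apply, Subtype.forall, Finset.mem_Iic]
      constructor
      · exact fun h => ⟨fun i hi => h i (by omega), h _ le_rfl⟩
      · rintro ⟨h, h'⟩ i hi
        rcases Nat.le_succ_iff.1 hi with hi | rfl
        · exact h i hi
        · exact h'
    rw [hs, ← h2]
    change weightMeasure (fun b => M.trans n (a n) b) _ * _ = _
    rw [weightMeasure_singleton, ← ENNReal.ofReal_mul ((M.trans_row_mem n _).1 _),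
      Finset.prod_range_succ]
    congr 1
    ring

/-- All masses `λ(a)` and all transition probabilities are positive. -/
def NonDegenerate (M : MarkovPair) : Prop :=
  (∀ a, 0 < M.init a) ∧ ∀ n a b, 0 < M.trans n a b

/-- The infimum over `n`, `i`, `j` of the transition probabilities is positive. -/
def UniformlyPositive (M : MarkovPair) : Prop :=
  ∃ δ : ℝ, 0 < δ ∧ ∀ n i j, δ ≤ M.trans n i j

/-- The sum, over all words `a₁, …, aₙ₊₁` of length `n + 1` in `{0,1}` (indexed from `0`), of
`√(κ(a₁) λ(a₁)) ∏ᵢ √(Q⁽ⁱ⁾(aᵢ, aᵢ₊₁) P⁽ⁱ⁾(aᵢ, aᵢ₊₁))`, where `M = (λ, P)` and `N = (κ, Q)`. -/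
noncomputable def hellingerSum (M N : MarkovPair) (n : ℕ) : ℝ :=
  ∑ a : Fin (n + 1) → Fin 2, √(N.init (a 0) * M.init (a 0)) *
    ∏ i : Fin n, √(N.trans i (a i.castSucc) (a i.succ) * M.trans i (a i.castSucc) (a i.succ))

/-- The partial products of `κ(x₁)/λ(x₁) · ∏ⱼ Q⁽ʲ⁾(xⱼ, xⱼ₊₁) / P⁽ʲ⁾(xⱼ, xⱼ₊₁)`, where
`M = (λ, P)` and `N = (κ, Q)`. -/
noncomputable def ratioProd (M N : MarkovPair) (n : ℕ) (x : ℕ → Fin 2) : ℝ :=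
  N.init (x 0) / M.init (x 0) *
    ∏ j ∈ Finset.range n, N.trans j (x j) (x (j + 1)) / M.trans j (x j) (x (j + 1))

end MarkovPair

/-- Two measures are equivalent if they have the same null sets. -/
def EquivMeasures {Ω : Type*} [MeasurableSpace Ω] (ν μ : Measure Ω) : Prop :=
  ν ≪ μ ∧ μ ≪ ν

/-!
Write `μ = M.measure`, `ν = N.measure`, and let `Zₙ = ratioProd M N n`, the ratio of the masses
which `ν` and `μ` give to the cylinders over `0, …, n`. Three facts carry the proof.

*Likelihood ratios.* By martingale convergence (`tendsto_rnDeriv_of_wordCylinder`) `Zₙ → dν/dμ`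
almost everywhere if `ν ≪ μ`. The same theorem for `μ` relative to `μ + ν` gives
`1 / (1 + Zₙ) → dμ/d(μ + ν)` without any hypothesis, so that `μ ≪ ν` as soon as
`μ (Zₙ → 0) = 0` (`absolutelyContinuous_of_not_tendsto`).

*Zero-one law.* The event `Zₙ → 0` belongs to the tail, since changing finitely many coordinates
changes `Zₙ` by a positive factor. The conditional probabilities of a tail event given the present
state are harmonic for the chain, and their oscillation is multiplied by `1 - P(0,1) - P(1,0)` at
each step. If the product of these factors did not vanish, the path which stays put or moves
according to their signs would be an atom (`tendsto_prod_contraction`). Hence the conditional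
probabilities are constant, and the tail is trivial (`measure_tail_eq_zero_or_one`).

*Hellinger sums.* The sums `Lₙ = hellingerSum M N n` equal `∫ √Zₙ dμ` and decrease. As `√Zₙ` is
bounded in `L²(μ)`, they tend to `0` if `Zₙ → 0` almost everywhere
(`limit_hellingerSum_eq_zero`). So a nonzero limit excludes `μ (Zₙ → 0) = 1`, and the zero-one law
gives `μ ≪ ν`; the sums being symmetric, `ν ≪ μ` as well. Conversely, under equivalence
`Zₙ → dν/dμ > 0`, which keeps the sums away from `0`.

For the criterion in terms of the matrices, the decrease `Lₙ - Lₙ₊₁` is the sum over the states `a`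
of the part of `Lₙ` coming from words ending in `a`, times the defect `1 - ∑ b, √(Q a b * P a b)`.
Under uniform positivity this part is comparable to `Lₙ` and the defect to `∑ b, (P a b - Q a b)²`,
so that the limit is positive if and only if the squares are summable
(`limit_hellingerSum_ne_zero_iff`).
-/

/-! ### Cylinders -/

/-- The cylinder of the sequences which agree with `a` at the times `0, …, n`. -/
def wordCylinder (n : ℕ) (a : ℕ → Fin 2) : Set (ℕ → Fin 2) := {x | ∀ i ≤ n, x i = a i}

theorem mem_wordCylinder_self (n : ℕ) (a : ℕ → Fin 2) : a ∈ wordCylinder n a := fun _ _ => rfl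

theorem wordCylinder_eq_of_mem {n : ℕ} {a x : ℕ → Fin 2} (h : x ∈ wordCylinder n a) :
    wordCylinder n a = wordCylinder n x := by
  ext y
  exact ⟨fun hy i hi => (hy i hi).trans (h i hi).symm, fun hy i hi => (hy i hi).trans (h i hi)⟩

/-- Every word indexed by `0, …, n` is a restriction of a sequence, so that its preimage under the
restriction map is a cylinder. -/
theorem exists_preimage_singleton_eq_wordCylinder (n : ℕ) (w : Π _ : Finset.Iic n, Fin 2) :
    ∃ a : ℕ → Fin 2,
      Preorder.frestrictLe (π := fun _ : ℕ => Fin 2) n ⁻¹' {w} = wordCylinder n a := by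
  refine ⟨fun i => if h : i ≤ n then w ⟨i, by simpa using h⟩ else 0, ?_⟩
  rw [wordCylinder, MarkovPair.cylinder_eq]
  congr 2
  funext ⟨i, hi⟩
  have : i ≤ n := by simpa using hi
  simp [this]

theorem measurable_frestrictLe (n : ℕ) :
    Measurable (Preorder.frestrictLe (π := fun _ : ℕ => Fin 2) n) := by
  fun_prop

theorem measurableSet_wordCylinder (n : ℕ) (a : ℕ → Fin 2) : MeasurableSet (wordCylinder n a) := by
  rw [wordCylinder, MarkovPair.cylinder_eq]
  exact measurable_frestrictLe n (MeasurableSet.singleton _)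

theorem generateFrom_wordCylinder :
    (inferInstance : MeasurableSpace (ℕ → Fin 2)) =
      MeasurableSpace.generateFrom {s | ∃ n a, s = wordCylinder n a} := by
  apply le_antisymm
  · refine iSup_le fun i => ?_
    rw [← measurable_iff_comap_le]
    have h : Measurable[MeasurableSpace.generateFrom {s | ∃ n a, s = wordCylinder n a}]
        (Preorder.frestrictLe (π := fun _ : ℕ => Fin 2) i) := by
      refine @measurable_to_countable' _ _ _ _
        (MeasurableSpace.generateFrom {s | ∃ n a, s = wordCylinder n a}) _ fun w => ?_
      obtain ⟨a, ha⟩ := exists_preimage_singleton_eq_wordCylinder i w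
      exact MeasurableSpace.measurableSet_generateFrom ⟨i, a, ha⟩
    exact (measurable_pi_apply (⟨i, by simp⟩ : Finset.Iic i)).comp h
  · refine MeasurableSpace.generateFrom_le ?_
    rintro _ ⟨n, a, rfl⟩
    exact measurableSet_wordCylinder n a

theorem isPiSystem_wordCylinder : IsPiSystem {s | ∃ n a, s = wordCylinder n a} := by
  rintro _ ⟨n, a, rfl⟩ _ ⟨m, b, rfl⟩ ⟨x, hxa, hxb⟩
  refine ⟨max n m, x, ?_⟩
  rw [wordCylinder_eq_of_mem hxa, wordCylinder_eq_of_mem hxb]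
  ext y
  exact ⟨fun h i hi => (le_max_iff.1 hi).elim (h.1 i) (h.2 i),
    fun h => ⟨fun i hi => h i (le_max_of_le_left hi), fun i hi => h i (le_max_of_le_right hi)⟩⟩

/-- Each cylinder over `0, …, n` splits into two cylinders over `0, …, n + 1`. -/
theorem measureReal_inter_wordCylinder_eq_sum (ρ : Measure (ℕ → Fin 2)) [IsFiniteMeasure ρ]
    (s : Set (ℕ → Fin 2)) (n : ℕ) (a : ℕ → Fin 2) :
    ρ.real (s ∩ wordCylinder n a) =
      ∑ c, ρ.real (s ∩ wordCylinder (n + 1) (Function.update a (n + 1) c)) := by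
  have hs : ∀ c, s ∩ wordCylinder (n + 1) (Function.update a (n + 1) c) =
      (s ∩ wordCylinder n a) ∩ {x | x (n + 1) = c} := by
    intro c
    ext x
    simp only [wordCylinder, Set.mem_inter_iff, Set.mem_ofPred_eq, and_assoc, and_congr_right_iff]
    refine fun _ => ⟨fun h => ⟨fun i hi => ?_, by simpa using h (n + 1) le_rfl⟩, fun h i hi => ?_⟩
    · rw [h i (by omega), Function.update_of_ne (by omega)]
    · rcases Nat.le_succ_iff.1 hi with hi | rfl
      · rw [Function.update_of_ne (by omega), h.1 i hi]
      · simp [h.2]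
  have hc : {x : ℕ → Fin 2 | x (n + 1) = 0}ᶜ = {x | x (n + 1) = 1} := by
    ext x
    simp only [Set.mem_compl_iff, Set.mem_ofPred_eq]
    omega
  have hm : MeasurableSet {x : ℕ → Fin 2 | x (n + 1) = 0} :=
    measurable_pi_apply (n + 1) (MeasurableSet.singleton 0)
  rw [Fin.sum_univ_two, hs, hs, ← hc, ← Set.sdiff_eq, measureReal_inter_add_sdiff hm]

theorem univ_eq_iUnion_wordCylinder_zero :
    (Set.univ : Set (ℕ → Fin 2)) = ⋃ c, wordCylinder 0 fun _ => c := by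
  ext x
  simp [wordCylinder]

/-- Finite measures which agree on the cylinders are equal. -/
theorem measure_ext_wordCylinder {ρ σ : Measure (ℕ → Fin 2)} [IsFiniteMeasure ρ]
    (h : ∀ n a, ρ (wordCylinder n a) = σ (wordCylinder n a)) : ρ = σ := by
  refine ext_of_generate_finite _ generateFrom_wordCylinder isPiSystem_wordCylinder ?_ ?_
  · rintro _ ⟨n, a, rfl⟩
    exact h n a
  · have hd : Pairwise (Function.onFun Disjoint fun c : Fin 2 => wordCylinder 0 fun _ => c) := by
      intro c d hcd
      refine Set.disjoint_left.2 fun x hc hd => hcd ?_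
      exact (hc 0 le_rfl).symm.trans (hd 0 le_rfl)
    rw [univ_eq_iUnion_wordCylinder_zero, measure_iUnion hd fun c => measurableSet_wordCylinder _ _,
      measure_iUnion hd fun c => measurableSet_wordCylinder _ _]
    simp_rw [h]

/-! ### Densities as limits of ratios on cylinders -/

theorem measurable_of_wordCylinder {n : ℕ} {h : (ℕ → Fin 2) → ℝ}
    (hd : ∀ x, ∀ y ∈ wordCylinder n x, h y = h x) :
    Measurable[Filtration.piLE (X := fun _ : ℕ => Fin 2) n] h := by
  rw [Filtration.piLE_eq_comap_frestrictLe]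
  have hcomp : h = (fun w : (Π _ : Finset.Iic n, Fin 2) =>
        h fun i => if hi : i ≤ n then w ⟨i, by simpa using hi⟩ else 0) ∘
      Preorder.frestrictLe (π := fun _ : ℕ => Fin 2) n := by
    funext x
    refine (hd x _ fun i hi => ?_).symm
    simp [hi]
  rw [hcomp]
  exact Measurable.of_discrete.comp (comap_measurable _)

/-- Martingale convergence on `{0,1}^ℕ`: if `ν ≪ ρ` and `h n` is the function, constant on the
cylinders over `0, …, n`, whose values are the ratios of the masses which `ν` and `ρ` give to them,
then `h n` is a conditional expectation of `dν/dρ`, hence tends to it almost everywhere. -/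
theorem tendsto_rnDeriv_of_wordCylinder {ρ ν : Measure (ℕ → Fin 2)} [IsFiniteMeasure ρ]
    [IsFiniteMeasure ν] (hac : ν ≪ ρ) {h : ℕ → (ℕ → Fin 2) → ℝ} (h0 : ∀ n x, 0 ≤ h n x)
    (hd : ∀ n x, ∀ y ∈ wordCylinder n x, h n y = h n x)
    (hr : ∀ n x, ENNReal.ofReal (h n x) * ρ (wordCylinder n x) = ν (wordCylinder n x)) :
    ∀ᵐ x ∂ρ, Tendsto (fun n => h n x) atTop (𝓝 (ν.rnDeriv ρ x).toReal) := by
  set F := Filtration.piLE (X := fun _ : ℕ => Fin 2) with hF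
  set g : (ℕ → Fin 2) → ℝ := fun x => (ν.rnDeriv ρ x).toReal with hg
  have hgm : Measurable g := (Measure.measurable_rnDeriv ν ρ).ennreal_toReal
  have hgi : Integrable g ρ := Measure.integrable_toReal_rnDeriv
  have hFm : ∀ n, Measurable (h n) := fun n =>
    (measurable_of_wordCylinder (hd n)).mono (F.le n) le_rfl
  have hmap : ∀ n, (ρ.withDensity fun x => ENNReal.ofReal (h n x)).map
      (Preorder.frestrictLe (π := fun _ : ℕ => Fin 2) n) =
      ν.map (Preorder.frestrictLe (π := fun _ : ℕ => Fin 2) n) := by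
    intro n
    refine Measure.ext_of_singleton fun w => ?_
    obtain ⟨a, ha⟩ := exists_preimage_singleton_eq_wordCylinder n w
    rw [Measure.map_apply (measurable_frestrictLe n) (MeasurableSet.singleton w),
      Measure.map_apply (measurable_frestrictLe n) (MeasurableSet.singleton w), ha,
      withDensity_apply _ (measurableSet_wordCylinder n a), ← hr n a,
      setLIntegral_congr_fun (g := fun _ => ENNReal.ofReal (h n a)) (measurableSet_wordCylinder n a)
        (fun y hy => by simp only [hd n a y hy]), setLIntegral_const]
  have hset : ∀ n s, MeasurableSet[F n] s → ∫⁻ x in s, ENNReal.ofReal (h n x) ∂ρ = ν s := by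
    intro n s hs
    have hs' : MeasurableSet s := F.le n s hs
    rw [hF, Filtration.piLE_eq_comap_frestrictLe] at hs
    obtain ⟨t, ht, rfl⟩ := hs
    rw [← withDensity_apply _ hs', ← Measure.map_apply (measurable_frestrictLe n) ht, hmap n,
      Measure.map_apply (measurable_frestrictLe n) ht]
  have hint : ∀ n, Integrable (h n) ρ := by
    intro n
    refine ⟨(hFm n).aestronglyMeasurable, ?_⟩
    rw [hasFiniteIntegral_iff_ofReal (ae_of_all _ (h0 n)), ← setLIntegral_univ,
      hset n _ MeasurableSet.univ]
    exact measure_lt_top _ _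
  have hce : ∀ n, h n =ᵐ[ρ] ρ[g | F n] := by
    intro n
    refine ae_eq_condExp_of_forall_setIntegral_eq (F.le n) hgi
      (fun s _ _ => (hint n).integrableOn) (fun s hs _ => ?_)
      (measurable_of_wordCylinder (hd n)).stronglyMeasurable.aestronglyMeasurable
    rw [Measure.setIntegral_toReal_rnDeriv hac,
      integral_eq_lintegral_of_nonneg_ae (ae_of_all _ (h0 n)) (hFm n).aestronglyMeasurable,
      hset n s hs]
    rfl
  have hsup : (⨆ n, F n : MeasurableSpace (ℕ → Fin 2)) = MeasurableSpace.pi := by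
    refine le_antisymm (iSup_le fun n => F.le n) (iSup_le fun i => le_iSup_of_le i ?_)
    rw [← measurable_iff_comap_le, hF, Filtration.piLE_eq_comap_frestrictLe]
    exact (measurable_pi_apply (⟨i, by simp⟩ : Finset.Iic i)).comp
      (comap_measurable (Preorder.frestrictLe (π := fun _ : ℕ => Fin 2) i))
  have hlim := tendsto_ae_condExp (μ := ρ) (ℱ := F) g
  rw [hsup, condExp_of_stronglyMeasurable le_rfl hgm.stronglyMeasurable hgi] at hlim
  filter_upwards [hlim, ae_all_iff.2 hce] with x hx hx'
  simpa only [hx'] using hx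

/-! ### The Markov property and the zero-one law -/

namespace MarkovPair

/-- The mass `λ(x₀) ∏ᵢ Pᵢ(xᵢ, xᵢ₊₁)` of the cylinder over `0, …, n` around `x`. -/
noncomputable def cylinderMass (M : MarkovPair) (n : ℕ) (x : ℕ → Fin 2) : ℝ :=
  M.init (x 0) * ∏ i ∈ Finset.range n, M.trans i (x i) (x (i + 1))

theorem cylinderMass_nonneg (M : MarkovPair) (n : ℕ) (x : ℕ → Fin 2) : 0 ≤ M.cylinderMass n x :=
  mul_nonneg (M.init_mem.1 _) (Finset.prod_nonneg fun i _ => (M.trans_row_mem i _).1 _)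

theorem NonDegenerate.cylinderMass_pos {M : MarkovPair} (hM : M.NonDegenerate) (n : ℕ)
    (x : ℕ → Fin 2) : 0 < M.cylinderMass n x :=
  mul_pos (hM.1 _) (Finset.prod_pos fun _ _ => hM.2 _ _ _)

theorem cylinderMass_congr (M : MarkovPair) {n : ℕ} {x y : ℕ → Fin 2} (h : y ∈ wordCylinder n x) :
    M.cylinderMass n y = M.cylinderMass n x := by
  rw [cylinderMass, cylinderMass, h 0 (Nat.zero_le n)]
  congr 1
  refine Finset.prod_congr rfl fun i hi => ?_
  rw [Finset.mem_range] at hi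
  rw [h i hi.le, h (i + 1) hi]

theorem measure_wordCylinder (M : MarkovPair) (n : ℕ) (x : ℕ → Fin 2) :
    M.measure (wordCylinder n x) = ENNReal.ofReal (M.cylinderMass n x) :=
  M.measure_cylinder n x

theorem measureReal_wordCylinder (M : MarkovPair) (n : ℕ) (x : ℕ → Fin 2) :
    M.measure.real (wordCylinder n x) = M.cylinderMass n x := by
  rw [measureReal_def, measure_wordCylinder, ENNReal.toReal_ofReal (M.cylinderMass_nonneg n x)]

/-- The chain restarted at time `n` from the state `b`. -/
noncomputable def startAt (M : MarkovPair) (n : ℕ) (b : Fin 2) : MarkovPair where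
  init := Pi.single b 1
  init_mem := single_mem_stdSimplex ℝ b
  trans k := M.trans (n + k)
  trans_mem k := M.trans_mem (n + k)

/-- The sequence `x` seen from time `n` on. -/
def shift (n : ℕ) (x : ℕ → Fin 2) : ℕ → Fin 2 := fun k => x (n + k)

theorem measurable_shift (n : ℕ) : Measurable (shift n) :=
  measurable_pi_lambda _ fun k => measurable_pi_apply (n + k)

/-- The Markov property: given the coordinates `0, …, n`, the sequence from time `n` on is
distributed as the chain restarted at time `n` from the present state. -/
theorem measure_wordCylinder_inter_shift (M : MarkovPair) (n : ℕ) (a : ℕ → Fin 2)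
    {C : Set (ℕ → Fin 2)} (hC : MeasurableSet C) :
    M.measure (wordCylinder n a ∩ shift n ⁻¹' C) =
      M.measure (wordCylinder n a) * (M.startAt n (a n)).measure C := by
  have key : (M.measure.restrict (wordCylinder n a)).map (shift n) =
      M.measure (wordCylinder n a) • (M.startAt n (a n)).measure := by
    have := isFiniteMeasure_iff (M.measure.restrict (wordCylinder n a)) |>.2 (measure_lt_top _ _)
    refine measure_ext_wordCylinder fun k c => ?_
    rw [Measure.map_apply (measurable_shift n) (measurableSet_wordCylinder k c),
      Measure.restrict_apply (measurable_shift n (measurableSet_wordCylinder k c)),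
      Measure.smul_apply, smul_eq_mul, measure_wordCylinder, measure_wordCylinder]
    by_cases hc : c 0 = a n
    · set x : ℕ → Fin 2 := fun i => if i ≤ n then a i else c (i - n) with hx
      have hxa : ∀ i ≤ n, x i = a i := fun i hi => by simp [hx, hi]
      have hxc : ∀ i, x (n + i) = c i := by
        intro i
        rcases Nat.eq_zero_or_pos i with rfl | hi
        · simp [hx, hc]
        · simp [hx, hi.ne']
      have hs : shift n ⁻¹' wordCylinder k c ∩ wordCylinder n a = wordCylinder (n + k) x := by
        ext y
        constructor
        · rintro ⟨h1, h2⟩ i hi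
          rcases le_total i n with h | h
          · rw [h2 i h, hxa i h]
          · obtain ⟨j, rfl⟩ := Nat.exists_eq_add_of_le h
            exact (h1 j (by omega)).trans (hxc j).symm
        · exact fun h => ⟨fun i hi => (h (n + i) (by omega)).trans (hxc i),
            fun i hi => (h i (by omega)).trans (hxa i hi)⟩
      rw [hs, measure_wordCylinder, ← ENNReal.ofReal_mul (M.cylinderMass_nonneg n a)]
      congr 1
      rw [cylinderMass, Finset.prod_range_add, ← mul_assoc]
      change M.cylinderMass n x * _ = _
      rw [M.cylinderMass_congr (show x ∈ wordCylinder n a from hxa)]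
      simp only [cylinderMass, startAt, hc, Pi.single_eq_same, one_mul, add_assoc, hxc]
    · have hs : shift n ⁻¹' wordCylinder k c ∩ wordCylinder n a = ∅ := by
        refine Set.eq_empty_of_forall_notMem fun y hy => hc ?_
        exact (hy.1 0 (Nat.zero_le k)).symm.trans (hy.2 n le_rfl)
      rw [hs, measure_empty]
      simp [cylinderMass, startAt, Pi.single_eq_of_ne hc]
  have h := congrArg (fun m => m C) key
  beta_reduce at h
  rwa [Measure.map_apply (measurable_shift n) hC, Measure.restrict_apply (measurable_shift n hC),
    Measure.smul_apply, smul_eq_mul, Set.inter_comm] at h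

/-- The determinant `1 - P(0,1) - P(1,0)` of the transition matrix at time `n`, which is its
eigenvalue other than `1`. -/
noncomputable def contraction (M : MarkovPair) (n : ℕ) : ℝ :=
  1 - M.trans n 0 1 - M.trans n 1 0

theorem trans_zero_add (M : MarkovPair) (n : ℕ) (a : Fin 2) :
    M.trans n a 0 + M.trans n a 1 = 1 := by
  simpa using (M.trans_row_mem n a).2

/-- A sequence along which every transition has probability at least `|contraction n|`: it keeps
its state when the contraction factor is nonnegative and changes it otherwise. -/
theorem exists_path (M : MarkovPair) :
    ∃ x : ℕ → Fin 2, ∀ n, |M.contraction n| ≤ M.trans n (x n) (x (n + 1)) := by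
  have hex : ∀ n a, ∃ b, |M.contraction n| ≤ M.trans n a b := by
    intro n a
    have h0 := M.trans_zero_add n 0
    have h1 := M.trans_zero_add n 1
    have n00 := (M.trans_row_mem n 0).1 0
    have n01 := (M.trans_row_mem n 0).1 1
    have n10 := (M.trans_row_mem n 1).1 0
    have n11 := (M.trans_row_mem n 1).1 1
    rcases le_total 0 (M.contraction n) with h | h
    · refine ⟨a, ?_⟩
      rw [abs_of_nonneg h, contraction]
      fin_cases a <;> simp <;> linarith
    · refine ⟨1 - a, ?_⟩
      rw [abs_of_nonpos h, contraction]
      fin_cases a <;> simp <;> linarith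
  choose f hf using hex
  exact ⟨fun n => Nat.rec 0 (fun n a => f n a) n, fun n => hf n _⟩

/-- Along the path of `exists_path`, cylinder masses are multiplied at each step by at least the
modulus of the contraction factor. Without atoms they tend to `0`, hence so do the products of these
moduli from any time `m` on. -/
theorem tendsto_prod_contraction {M : MarkovPair} (hM : M.NonDegenerate)
    (hMa : ∀ x, M.measure {x} = 0) (m : ℕ) :
    Tendsto (fun k => ∏ i ∈ Finset.range k, |M.contraction (m + i)|) atTop (𝓝 0) := by
  obtain ⟨x, hx⟩ := M.exists_path
  have hmeas : Tendsto (fun n => M.measure (wordCylinder n x)) atTop (𝓝 0) := by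
    have h := tendsto_measure_iInter_atTop (μ := M.measure) (s := fun n => wordCylinder n x)
      (fun n => (measurableSet_wordCylinder n x).nullMeasurableSet)
      (fun n m hnm y hy i hi => hy i (hi.trans hnm)) ⟨0, measure_ne_top _ _⟩
    have hi : ⋂ n, wordCylinder n x = {x} := by
      ext y
      simp only [Set.mem_iInter, Set.mem_singleton_iff]
      exact ⟨fun h => funext fun n => h n n le_rfl, fun h n => h ▸ mem_wordCylinder_self n _⟩
    rwa [hi, hMa] at h
  have hmass : Tendsto (fun n => M.cylinderMass n x) atTop (𝓝 0) := by
    have h := (ENNReal.tendsto_toReal ENNReal.zero_ne_top).comp hmeas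
    simpa [Function.comp_def, measure_wordCylinder,
      ENNReal.toReal_ofReal (M.cylinderMass_nonneg _ x)] using h
  have hshift : Tendsto (fun k => M.cylinderMass (m + k) x / M.cylinderMass m x) atTop (𝓝 0) := by
    have h := (((tendsto_add_atTop_iff_nat m).2 hmass).div_const (M.cylinderMass m x))
    simpa only [zero_div, add_comm] using h
  refine squeeze_zero (fun k => Finset.prod_nonneg fun i _ => abs_nonneg _) (fun k => ?_) hshift
  have hsplit : M.cylinderMass (m + k) x / M.cylinderMass m x =
      ∏ i ∈ Finset.range k, M.trans (m + i) (x (m + i)) (x (m + i + 1)) := by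
    rw [div_eq_iff (hM.cylinderMass_pos m x).ne', cylinderMass, cylinderMass,
      Finset.prod_range_add]
    simp only [add_assoc]
    ring
  rw [hsplit]
  exact Finset.prod_le_prod (fun i _ => abs_nonneg _) fun i _ => hx (m + i)

/-- A bounded sequence of functions on the states which is harmonic for the transition matrices is
constant if the product of the contraction factors vanishes. -/
theorem harmonic_const {M : MarkovPair} (hM : M.NonDegenerate) (hMa : ∀ x, M.measure {x} = 0)
    {g : ℕ → Fin 2 → ℝ} (hg0 : ∀ n b, 0 ≤ g n b) (hg1 : ∀ n b, g n b ≤ 1)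
    (hg : ∀ n a, g n a = ∑ c, M.trans n a c * g (n + 1) c) (n : ℕ) (b : Fin 2) :
    g n b = g 0 0 := by
  have hosc : ∀ n, g n 0 - g n 1 = M.contraction n * (g (n + 1) 0 - g (n + 1) 1) := by
    intro n
    rw [hg n 0, hg n 1, Fin.sum_univ_two, Fin.sum_univ_two, contraction]
    linear_combination g (n + 1) 0 * M.trans_zero_add n 0 - g (n + 1) 1 * M.trans_zero_add n 1
  have hiter : ∀ n k, |g n 0 - g n 1| =
      (∏ i ∈ Finset.range k, |M.contraction (n + i)|) * |g (n + k) 0 - g (n + k) 1| := by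
    intro n k
    induction k with
    | zero => simp
    | succ k ih => rw [ih, hosc (n + k), abs_mul, Finset.prod_range_succ, mul_assoc]; rfl
  have heq : ∀ n, g n 0 = g n 1 := by
    intro n
    rw [← sub_eq_zero, ← abs_nonpos_iff]
    refine ge_of_tendsto' (tendsto_prod_contraction hM hMa n) fun k => ?_
    rw [hiter n k]
    refine mul_le_of_le_one_right (Finset.prod_nonneg fun i _ => abs_nonneg _) ?_
    rw [abs_le]
    constructor <;> linarith [hg0 (n + k) 0, hg0 (n + k) 1, hg1 (n + k) 0, hg1 (n + k) 1]
  have hall : ∀ n b, g n b = g n 0 := by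
    intro n b
    fin_cases b
    · rfl
    · exact (heq n).symm
  rw [hall n b]
  induction n with
  | zero => rfl
  | succ n ih =>
    rw [← ih, hg n 0, Fin.sum_univ_two, ← heq (n + 1), ← add_mul, M.trans_zero_add, one_mul]

/-- The zero-one law: a non-degenerate Markov measure without atoms is trivial on tail events. The
conditional probabilities of a tail event given the present state form a harmonic sequence, hence
are constant, so that the event is independent of every cylinder and of itself. -/
theorem measure_tail_eq_zero_or_one {M : MarkovPair} (hM : M.NonDegenerate)
    (hMa : ∀ x, M.measure {x} = 0) {A : Set (ℕ → Fin 2)} {B : ℕ → Set (ℕ → Fin 2)}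
    (hB : ∀ n, MeasurableSet (B n)) (hA : ∀ n, A = shift n ⁻¹' B n) :
    M.measure A = 0 ∨ M.measure A = 1 := by
  set g : ℕ → Fin 2 → ℝ := fun n b => (M.startAt n b).measure.real (B n) with hg
  have hcyl : ∀ n a, M.measure.real (A ∩ wordCylinder n a) = M.cylinderMass n a * g n (a n) := by
    intro n a
    rw [← measureReal_wordCylinder, measureReal_def, Set.inter_comm, hA n,
      measure_wordCylinder_inter_shift M n a (hB n), ENNReal.toReal_mul]
    rfl
  have hharm : ∀ n b, g n b = ∑ c, M.trans n b c * g (n + 1) c := by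
    intro n b
    refine mul_left_cancel₀ (hM.cylinderMass_pos n fun _ => b).ne' ?_
    rw [← hcyl n fun _ => b, measureReal_inter_wordCylinder_eq_sum, Finset.mul_sum]
    refine Finset.sum_congr rfl fun c _ => ?_
    have hmem : Function.update (fun _ => b) (n + 1) c ∈ wordCylinder n fun _ => b :=
      fun i hi => Function.update_of_ne (by omega) _ _
    have hmass : M.cylinderMass (n + 1) (Function.update (fun _ => b) (n + 1) c) =
        (M.cylinderMass n fun _ => b) * M.trans n b c := by
      rw [← M.cylinderMass_congr hmem, cylinderMass, Finset.prod_range_succ, ← mul_assoc,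
        Function.update_self, hmem n le_rfl]
      rfl
    rw [hcyl, Function.update_self, hmass, mul_assoc]
  have hconst : ∀ n b, g n b = g 0 0 := harmonic_const hM hMa (fun n b => measureReal_nonneg)
    (fun n b => measureReal_le_one) hharm
  have hmeasA : MeasurableSet A := by
    rw [hA 0]
    exact measurable_shift 0 (hB 0)
  have hind : M.measure.restrict A = ENNReal.ofReal (g 0 0) • M.measure := by
    refine measure_ext_wordCylinder fun n a => ?_
    rw [Measure.restrict_apply (measurableSet_wordCylinder n a), Set.inter_comm, Measure.smul_apply,
      smul_eq_mul, measure_wordCylinder, ← ENNReal.ofReal_mul measureReal_nonneg,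
      ← ofReal_measureReal, hcyl, hconst, mul_comm]
  have h1 := congrArg (fun m => m Set.univ) hind
  have h2 := congrArg (fun m => m A) hind
  simp only [Measure.restrict_apply MeasurableSet.univ, Set.univ_inter, Measure.smul_apply,
    smul_eq_mul, measure_univ, mul_one] at h1
  simp only [Measure.restrict_apply hmeasA, Set.inter_self, Measure.smul_apply, smul_eq_mul,
    ← h1] at h2
  by_cases h0 : M.measure A = 0
  · exact Or.inl h0
  · refine Or.inr ?_
    nth_rw 1 [← mul_one (M.measure A)] at h2
    exact ((ENNReal.mul_right_inj h0 (measure_ne_top _ _)).1 h2).symm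

end MarkovPair

/-! ### The Hellinger sums as masses of a vector recursion -/

namespace MarkovPair

/-- The part of `hellingerSum M N n` which comes from the words ending in the letter `b`. -/
noncomputable def hellingerVec (M N : MarkovPair) : ℕ → Fin 2 → ℝ
  | 0, b => √(N.init b * M.init b)
  | n + 1, b => ∑ a, hellingerVec M N n a * √(N.trans n a b * M.trans n a b)

/-- The defect `1 - ∑ b, √(Q a b * P a b)` of the rows of index `a` at time `n`: half their squared
Hellinger distance. -/
noncomputable def rowDefect (M N : MarkovPair) (n : ℕ) (a : Fin 2) : ℝ :=
  1 - ∑ b, √(N.trans n a b * M.trans n a b)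

theorem sum_word_eq_sum_hellingerVec (M N : MarkovPair) (n : ℕ) (g : Fin 2 → ℝ) :
    ∑ a : Fin (n + 1) → Fin 2, √(N.init (a 0) * M.init (a 0)) *
      (∏ i : Fin n, √(N.trans i (a i.castSucc) (a i.succ) * M.trans i (a i.castSucc) (a i.succ))) *
        g (a (Fin.last n)) = ∑ b, hellingerVec M N n b * g b := by
  induction n generalizing g with
  | zero =>
    rw [← (Equiv.funUnique (Fin 1) (Fin 2)).symm.sum_comp]
    simp [hellingerVec]
  | succ n ih =>
    rw [← (Fin.snocEquiv fun _ : Fin (n + 2) => Fin 2).sum_comp, Fintype.sum_prod_type]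
    simp only [Fin.snocEquiv, Equiv.coe_fn_mk, Fin.snoc_last, hellingerVec, Finset.sum_mul]
    refine Finset.sum_congr rfl fun c _ => ?_
    have h := ih fun a => √(N.trans n a c * M.trans n a c) * g c
    simp only [mul_assoc] at h ⊢
    rw [← h]
    refine Finset.sum_congr rfl fun a _ => ?_
    rw [Fin.prod_univ_castSucc]
    have h0 : (Fin.snoc a c : Fin (n + 2) → Fin 2) 0 = a 0 := by
      rw [← Fin.castSucc_zero]; exact Fin.snoc_castSucc (α := fun _ => Fin 2) _ _ _
    have h1 : ∀ i, (Fin.snoc a c : Fin (n + 2) → Fin 2) (Fin.castSucc i) = a i :=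
      fun i => Fin.snoc_castSucc (α := fun _ => Fin 2) _ _ _
    have h2 : (Fin.snoc a c : Fin (n + 2) → Fin 2) (Fin.last (n + 1)) = c :=
      Fin.snoc_last (α := fun _ => Fin 2) _ _
    simp only [h0, h1, h2, Fin.succ_castSucc, Fin.val_castSucc, Fin.succ_last, Fin.val_last]
    ring

theorem hellingerSum_eq_sum_hellingerVec (M N : MarkovPair) (n : ℕ) :
    hellingerSum M N n = ∑ b, hellingerVec M N n b := by
  simpa [hellingerSum] using sum_word_eq_sum_hellingerVec M N n fun _ => 1

theorem hellingerSum_comm (M N : MarkovPair) (n : ℕ) : hellingerSum M N n = hellingerSum N M n := by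
  simp only [hellingerSum, mul_comm]

theorem hellingerVec_nonneg (M N : MarkovPair) (n : ℕ) (b : Fin 2) : 0 ≤ hellingerVec M N n b := by
  induction n generalizing b with
  | zero => exact Real.sqrt_nonneg _
  | succ n ih => exact Finset.sum_nonneg fun a _ => mul_nonneg (ih a) (Real.sqrt_nonneg _)

theorem hellingerSum_nonneg (M N : MarkovPair) (n : ℕ) : 0 ≤ hellingerSum M N n := by
  rw [hellingerSum_eq_sum_hellingerVec]
  exact Finset.sum_nonneg fun b _ => hellingerVec_nonneg M N n b

theorem hellingerSum_sub_succ (M N : MarkovPair) (n : ℕ) :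
    hellingerSum M N n - hellingerSum M N (n + 1) =
      ∑ a, hellingerVec M N n a * rowDefect M N n a := by
  simp only [hellingerSum_eq_sum_hellingerVec, hellingerVec, rowDefect, Fin.sum_univ_two]
  ring

/-- For two rows of stochastic matrices, `2 - 2 ∑ √(p q) = ∑ (√p - √q)²`. -/
theorem two_mul_rowDefect (M N : MarkovPair) (n : ℕ) (a : Fin 2) :
    2 * rowDefect M N n a = ∑ b, (√(M.trans n a b) - √(N.trans n a b)) ^ 2 := by
  have hM := M.trans_row_mem n a
  have hN := N.trans_row_mem n a
  have h : ∀ b, (√(M.trans n a b) - √(N.trans n a b)) ^ 2 =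
      M.trans n a b + N.trans n a b - 2 * √(N.trans n a b * M.trans n a b) := by
    intro b
    rw [Real.sqrt_mul (hN.1 b), sub_sq, Real.sq_sqrt (hM.1 b), Real.sq_sqrt (hN.1 b)]
    ring
  simp_rw [h]
  rw [Finset.sum_sub_distrib, Finset.sum_add_distrib, hM.2, hN.2, ← Finset.mul_sum, rowDefect]
  ring

theorem rowDefect_nonneg (M N : MarkovPair) (n : ℕ) (a : Fin 2) : 0 ≤ rowDefect M N n a := by
  have h := two_mul_rowDefect M N n a
  have : 0 ≤ ∑ b, (√(M.trans n a b) - √(N.trans n a b)) ^ 2 :=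
    Finset.sum_nonneg fun b _ => sq_nonneg _
  linarith

theorem antitone_hellingerSum (M N : MarkovPair) : Antitone (hellingerSum M N) := by
  refine antitone_nat_of_succ_le fun n => ?_
  rw [← sub_nonneg, hellingerSum_sub_succ]
  exact Finset.sum_nonneg fun a _ => mul_nonneg (hellingerVec_nonneg M N n a)
    (rowDefect_nonneg M N n a)

theorem exists_tendsto_hellingerSum (M N : MarkovPair) :
    ∃ L : ℝ, Tendsto (hellingerSum M N) atTop (𝓝 L) :=
  ⟨_, tendsto_atTop_ciInf (antitone_hellingerSum M N)
    ⟨0, by rintro _ ⟨n, rfl⟩; exact hellingerSum_nonneg M N n⟩⟩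

theorem sq_sub_le_rowDefect (M N : MarkovPair) (n : ℕ) (a b : Fin 2) :
    (M.trans n a b - N.trans n a b) ^ 2 ≤ 8 * rowDefect M N n a := by
  have hM := M.trans_row_mem n a
  have hN := N.trans_row_mem n a
  have h1 : (√(M.trans n a b) - √(N.trans n a b)) ^ 2 ≤ 2 * rowDefect M N n a := by
    rw [two_mul_rowDefect]
    exact Finset.single_le_sum (f := fun b => (√(M.trans n a b) - √(N.trans n a b)) ^ 2)
      (fun c _ => sq_nonneg _) (Finset.mem_univ b)
  have hp : √(M.trans n a b) ≤ 1 := Real.sqrt_le_one.2 ((mem_Icc_of_mem_stdSimplex hM b).2)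
  have hq : √(N.trans n a b) ≤ 1 := Real.sqrt_le_one.2 ((mem_Icc_of_mem_stdSimplex hN b).2)
  have h2 : (√(M.trans n a b) + √(N.trans n a b)) ^ 2 ≤ 4 := by
    nlinarith [Real.sqrt_nonneg (M.trans n a b), Real.sqrt_nonneg (N.trans n a b)]
  have h3 : (M.trans n a b - N.trans n a b) ^ 2 =
      (√(M.trans n a b) + √(N.trans n a b)) ^ 2 * (√(M.trans n a b) - √(N.trans n a b)) ^ 2 := by
    rw [← mul_pow, ← sq_sub_sq, Real.sq_sqrt (hM.1 b), Real.sq_sqrt (hN.1 b)]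
  rw [h3]
  nlinarith [sq_nonneg (√(M.trans n a b) - √(N.trans n a b)),
    sq_nonneg (√(M.trans n a b) + √(N.trans n a b))]

theorem rowDefect_le_sum_sq {M N : MarkovPair} {δ : ℝ} (hδ : 0 < δ)
    (hM : ∀ n i j, δ ≤ M.trans n i j) (n : ℕ) (a : Fin 2) :
    rowDefect M N n a ≤ (2 * δ)⁻¹ * ∑ b, (M.trans n a b - N.trans n a b) ^ 2 := by
  have hN := N.trans_row_mem n a
  have h : ∀ b, δ * (√(M.trans n a b) - √(N.trans n a b)) ^ 2 ≤
      (M.trans n a b - N.trans n a b) ^ 2 := by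
    intro b
    have hp := hδ.le.trans (hM n a b)
    have h3 : (M.trans n a b - N.trans n a b) ^ 2 =
        (√(M.trans n a b) + √(N.trans n a b)) ^ 2 *
          (√(M.trans n a b) - √(N.trans n a b)) ^ 2 := by
      rw [← mul_pow, ← sq_sub_sq, Real.sq_sqrt hp, Real.sq_sqrt (hN.1 b)]
    rw [h3]
    refine mul_le_mul_of_nonneg_right ?_ (sq_nonneg _)
    have := Real.sq_sqrt hp
    nlinarith [hM n a b, Real.sqrt_nonneg (M.trans n a b), Real.sqrt_nonneg (N.trans n a b),
      mul_nonneg (Real.sqrt_nonneg (M.trans n a b)) (Real.sqrt_nonneg (N.trans n a b))]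
  have h2 := Finset.sum_le_sum fun b (_ : b ∈ Finset.univ) => h b
  rw [← Finset.mul_sum, ← two_mul_rowDefect] at h2
  rw [inv_mul_eq_div, le_div_iff₀ (by positivity)]
  linarith

theorem hellingerSum_pos {M N : MarkovPair} (hM : M.NonDegenerate) (hN : N.NonDegenerate) (n : ℕ) :
    0 < hellingerSum M N n := by
  refine Finset.sum_pos (fun a _ => ?_) Finset.univ_nonempty
  exact mul_pos (Real.sqrt_pos.2 (mul_pos (hN.1 _) (hM.1 _)))
    (Finset.prod_pos fun i _ => Real.sqrt_pos.2 (mul_pos (hN.2 _ _ _) (hM.2 _ _ _)))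

/-- If the row defects are dominated by a summable sequence, the Hellinger sums cannot tend to `0`:
past a time `m` after which the dominating series is at most `1 / 2`, they lose at most half of
their value at `m`. -/
theorem limit_hellingerSum_pos {M N : MarkovPair} (hM : M.NonDegenerate) (hN : N.NonDegenerate)
    {L : ℝ} (hL : Tendsto (hellingerSum M N) atTop (𝓝 L)) {ε : ℕ → ℝ} (hε : Summable ε)
    (h : ∀ n a, rowDefect M N n a ≤ ε n) : 0 < L := by
  have hε0 : ∀ n, 0 ≤ ε n := fun n => (rowDefect_nonneg M N n 0).trans (h n 0)
  obtain ⟨m, hm⟩ : ∃ m, ∑' k, ε (k + m) < 1 / 2 :=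
    ((tendsto_order.1 (tendsto_sum_nat_add ε)).2 _ (by norm_num)).exists
  have hstep : ∀ n, hellingerSum M N n - hellingerSum M N (n + 1) ≤ hellingerSum M N n * ε n := by
    intro n
    rw [hellingerSum_sub_succ, hellingerSum_eq_sum_hellingerVec, Finset.sum_mul]
    exact Finset.sum_le_sum fun a _ =>
      mul_le_mul_of_nonneg_left (h n a) (hellingerVec_nonneg M N n a)
  have hk : ∀ k, hellingerSum M N m * (1 - ∑ j ∈ Finset.range k, ε (j + m)) ≤
      hellingerSum M N (k + m) := by
    intro k
    induction k with
    | zero => simp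
    | succ k ih =>
      have h1 := hstep (k + m)
      have h2 := mul_le_mul_of_nonneg_right
        (antitone_hellingerSum M N (Nat.le_add_left m k)) (hε0 (k + m))
      rw [Finset.sum_range_succ, show k + 1 + m = k + m + 1 by ring]
      linarith
  have hlow : ∀ k, hellingerSum M N m / 2 ≤ hellingerSum M N (k + m) := by
    intro k
    have h1 : ∑ j ∈ Finset.range k, ε (j + m) ≤ ∑' k, ε (k + m) :=
      ((summable_nat_add_iff m).2 hε).sum_le_tsum _ fun j _ => hε0 _
    nlinarith [hk k, hellingerSum_pos hM hN m]
  have := ge_of_tendsto' ((tendsto_add_atTop_iff_nat m).2 hL) hlow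
  linarith [hellingerSum_pos hM hN m]

/-- Under uniform positivity each state carries a fixed proportion of every Hellinger sum. -/
theorem le_hellingerVec {M N : MarkovPair} {δ : ℝ} (hδ : 0 < δ)
    (hM : ∀ n i j, δ ≤ M.trans n i j) (hN : ∀ n i j, δ ≤ N.trans n i j) (n : ℕ) (b : Fin 2) :
    δ * hellingerSum M N (n + 1) ≤ hellingerVec M N (n + 1) b := by
  refine (mul_le_mul_of_nonneg_left (antitone_hellingerSum M N n.le_succ) hδ.le).trans ?_
  rw [hellingerSum_eq_sum_hellingerVec, hellingerVec, Finset.mul_sum]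
  refine Finset.sum_le_sum fun a _ => ?_
  rw [mul_comm]
  refine mul_le_mul_of_nonneg_left (Real.le_sqrt_of_sq_le ?_) (hellingerVec_nonneg M N n a)
  rw [sq]
  exact mul_le_mul (hN n a b) (hM n a b) hδ.le (hδ.le.trans (hN n a b))

/-- If the Hellinger sums stay above `L > 0`, the decrease at each step is at least `δ L` times the
row defect, and the decreases telescope. -/
theorem summable_rowDefect {M N : MarkovPair} {δ : ℝ} (hδ : 0 < δ)
    (hM : ∀ n i j, δ ≤ M.trans n i j) (hN : ∀ n i j, δ ≤ N.trans n i j)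
    {L : ℝ} (hL : Tendsto (hellingerSum M N) atTop (𝓝 L)) (hL0 : 0 < L) (a : Fin 2) :
    Summable fun n => rowDefect M N n a := by
  rw [← summable_nat_add_iff 1]
  have hLle : ∀ n, L ≤ hellingerSum M N n := (antitone_hellingerSum M N).le_of_tendsto hL
  have hstep : ∀ n, δ * L * rowDefect M N (n + 1) a ≤
      hellingerSum M N (n + 1) - hellingerSum M N (n + 1 + 1) := by
    intro n
    rw [hellingerSum_sub_succ]
    refine le_trans (mul_le_mul_of_nonneg_right ?_ (rowDefect_nonneg M N _ a))
      (Finset.single_le_sum (f := fun a => hellingerVec M N (n + 1) a * rowDefect M N (n + 1) a)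
        (fun c _ => mul_nonneg (hellingerVec_nonneg M N _ c) (rowDefect_nonneg M N _ c))
        (Finset.mem_univ a))
    exact (mul_le_mul_of_nonneg_left (hLle _) hδ.le).trans (le_hellingerVec hδ hM hN n a)
  refine summable_of_sum_range_le (c := (δ * L)⁻¹ * hellingerSum M N 1)
    (fun n => rowDefect_nonneg M N _ a) fun k => ?_
  rw [inv_mul_eq_div, le_div_iff₀ (by positivity), mul_comm, Finset.mul_sum]
  refine (Finset.sum_le_sum fun n _ => hstep n).trans ?_
  rw [Finset.sum_range_sub' (fun n => hellingerSum M N (n + 1))]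
  simpa using hellingerSum_nonneg M N (k + 1)

theorem limit_hellingerSum_ne_zero_iff {M N : MarkovPair} (hM : M.NonDegenerate)
    (hN : N.NonDegenerate) (hMu : M.UniformlyPositive) (hNu : N.UniformlyPositive)
    {L : ℝ} (hL : Tendsto (hellingerSum M N) atTop (𝓝 L)) :
    L ≠ 0 ↔ ∀ i j, Summable fun n => (M.trans n i j - N.trans n i j) ^ 2 := by
  obtain ⟨δ₁, h₁, hM'⟩ := hMu
  obtain ⟨δ₂, h₂, hN'⟩ := hNu
  constructor
  · intro h0 i j
    have hpos : 0 < L := (ge_of_tendsto' hL (hellingerSum_nonneg M N)).lt_of_ne' h0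
    refine Summable.of_nonneg_of_le (fun n => sq_nonneg _)
      (fun n => sq_sub_le_rowDefect M N n i j) (Summable.mul_left 8 ?_)
    exact summable_rowDefect (lt_min h₁ h₂) (fun n i j => (min_le_left _ _).trans (hM' n i j))
      (fun n i j => (min_le_right _ _).trans (hN' n i j)) hL hpos i
  · intro h
    have hs : Summable fun n => (2 * δ₁)⁻¹ * ∑ a, ∑ b, (M.trans n a b - N.trans n a b) ^ 2 :=
      (summable_sum fun a _ => summable_sum fun b _ => h a b).mul_left _
    refine (limit_hellingerSum_pos hM hN hL hs fun n a => ?_).ne'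
    refine (rowDefect_le_sum_sq h₁ hM' n a).trans (mul_le_mul_of_nonneg_left ?_ (by positivity))
    exact Finset.single_le_sum (f := fun a => ∑ b, (M.trans n a b - N.trans n a b) ^ 2)
      (fun c _ => Finset.sum_nonneg fun b _ => sq_nonneg _) (Finset.mem_univ a)

end MarkovPair

/-! ### Likelihood ratios and equivalence -/

namespace MarkovPair

theorem ratioProd_eq_div (M N : MarkovPair) (n : ℕ) (x : ℕ → Fin 2) :
    ratioProd M N n x = N.cylinderMass n x / M.cylinderMass n x := by
  rw [ratioProd, cylinderMass, cylinderMass, Finset.prod_div_distrib, div_mul_div_comm]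

theorem ratioProd_congr (M N : MarkovPair) {n : ℕ} {x y : ℕ → Fin 2} (h : y ∈ wordCylinder n x) :
    ratioProd M N n y = ratioProd M N n x := by
  rw [ratioProd_eq_div, ratioProd_eq_div, M.cylinderMass_congr h, N.cylinderMass_congr h]

theorem ratioProd_pos {M N : MarkovPair} (hM : M.NonDegenerate) (hN : N.NonDegenerate) (n : ℕ)
    (x : ℕ → Fin 2) : 0 < ratioProd M N n x := by
  rw [ratioProd_eq_div]
  exact div_pos (hN.cylinderMass_pos n x) (hM.cylinderMass_pos n x)

theorem measurable_ratioProd (M N : MarkovPair) (n : ℕ) : Measurable (ratioProd M N n) :=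
  (measurable_of_wordCylinder fun _ _ h => ratioProd_congr M N h).mono
    (Filtration.le _ n) le_rfl

theorem tendsto_ratioProd_rnDeriv {M N : MarkovPair} (hM : M.NonDegenerate) (hN : N.NonDegenerate)
    (hac : N.measure ≪ M.measure) :
    ∀ᵐ x ∂M.measure, Tendsto (fun n => ratioProd M N n x) atTop
      (𝓝 (N.measure.rnDeriv M.measure x).toReal) := by
  refine tendsto_rnDeriv_of_wordCylinder hac (fun n x => (ratioProd_pos hM hN n x).le)
    (fun n x y h => ratioProd_congr M N h) fun n x => ?_
  rw [measure_wordCylinder, measure_wordCylinder,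
    ← ENNReal.ofReal_mul (ratioProd_pos hM hN n x).le, ratioProd_eq_div,
    div_mul_cancel₀ _ (hM.cylinderMass_pos n x).ne']

/-- The Lebesgue decomposition in terms of likelihood ratios: the part of `M.measure` which is
singular to `N.measure` sits on the set where the likelihood ratio tends to `0`. The ratios
`1 / (1 + ratioProd)` converge to the density of `M.measure` with respect to the sum of the two
measures, and an `N.measure`-null set is one where this density is `1`. -/
theorem absolutelyContinuous_of_not_tendsto {M N : MarkovPair} (hM : M.NonDegenerate)
    (hN : N.NonDegenerate)
    (h0 : M.measure {x | Tendsto (fun n => ratioProd M N n x) atTop (𝓝 0)} = 0) :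
    M.measure ≪ N.measure := by
  set ρ := M.measure + N.measure with hρ
  have hMρ : M.measure ≪ ρ := Measure.absolutelyContinuous_of_le (Measure.le_add_right le_rfl)
  have hlim : ∀ᵐ x ∂ρ, Tendsto (fun n => (1 + ratioProd M N n x)⁻¹) atTop
      (𝓝 (M.measure.rnDeriv ρ x).toReal) := by
    refine tendsto_rnDeriv_of_wordCylinder hMρ
      (fun n x => inv_nonneg.2 (add_pos one_pos (ratioProd_pos hM hN n x)).le)
      (fun n x y h => by rw [ratioProd_congr M N h]) fun n x => ?_
    have hp := hM.cylinderMass_pos n x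
    have hq := hN.cylinderMass_pos n x
    rw [hρ, Measure.add_apply, measure_wordCylinder, measure_wordCylinder,
      ← ENNReal.ofReal_add hp.le hq.le, ← ENNReal.ofReal_mul (inv_nonneg.2
      (add_pos one_pos (ratioProd_pos hM hN n x)).le), ratioProd_eq_div]
    congr 1
    field_simp
  refine Measure.AbsolutelyContinuous.mk fun A hA hNA => ?_
  have hone : ∀ᵐ x ∂ρ, x ∈ A → (M.measure.rnDeriv ρ x).toReal = 1 := by
    have hadd := Measure.rnDeriv_add' M.measure N.measure ρ
    have hself := Measure.rnDeriv_self ρ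
    have hNzero : ∀ᵐ x ∂ρ, x ∈ A → N.measure.rnDeriv ρ x = 0 := by
      have hle : ∫⁻ x in A, N.measure.rnDeriv ρ x ∂ρ = 0 :=
        le_antisymm ((Measure.setLIntegral_rnDeriv_le A).trans hNA.le) bot_le
      rwa [setLIntegral_eq_zero_iff hA (Measure.measurable_rnDeriv _ _)] at hle
    filter_upwards [hadd, hself, hNzero] with x h1 h2 h3 hx
    rw [← hρ, h2, Pi.add_apply, h3 hx, add_zero] at h1
    rw [← h1, ENNReal.toReal_one]
  refine measure_mono_null_ae ?_ h0
  filter_upwards [hMρ.ae_le hlim, hMρ.ae_le hone] with x hx h1 hxA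
  rw [h1 hxA] at hx
  have := (hx.inv₀ one_ne_zero).sub_const 1
  simp only [inv_one, sub_self, inv_inv, add_sub_cancel_left] at this
  exact this

theorem ratioProd_add (M N : MarkovPair) (n k : ℕ) (x : ℕ → Fin 2) :
    ratioProd M N (n + k) x = ratioProd M N n x *
      ∏ j ∈ Finset.range k, N.trans (n + j) (shift n x j) (shift n x (j + 1)) /
        M.trans (n + j) (shift n x j) (shift n x (j + 1)) := by
  rw [ratioProd, Finset.prod_range_add, ← mul_assoc]
  rfl

/-- The vanishing of the limiting likelihood ratio is a tail event. -/
theorem measure_tendsto_ratioProd_zero {M N : MarkovPair} (hM : M.NonDegenerate)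
    (hN : N.NonDegenerate) (hMa : ∀ x, M.measure {x} = 0) :
    M.measure {x | Tendsto (fun n => ratioProd M N n x) atTop (𝓝 0)} = 0 ∨
      M.measure {x | Tendsto (fun n => ratioProd M N n x) atTop (𝓝 0)} = 1 := by
  refine measure_tail_eq_zero_or_one hM hMa
    (B := fun n => {y | Tendsto (fun k => ∏ j ∈ Finset.range k,
      N.trans (n + j) (y j) (y (j + 1)) / M.trans (n + j) (y j) (y (j + 1))) atTop (𝓝 0)})
    (fun n => measurableSet_tendsto _ fun k => ?_) fun n => ?_
  · have h2 : ∀ j, Measurable fun y : ℕ → Fin 2 =>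
        N.trans (n + j) (y j) (y (j + 1)) / M.trans (n + j) (y j) (y (j + 1)) := by
      intro j
      have h3 : Measurable fun p : Fin 2 × Fin 2 =>
        N.trans (n + j) p.1 p.2 / M.trans (n + j) p.1 p.2 :=
        Measurable.of_discrete
      exact h3.comp (f := fun y : ℕ → Fin 2 => (y j, y (j + 1)))
        ((measurable_pi_apply j).prodMk (measurable_pi_apply (j + 1)))
    exact Finset.measurable_fun_prod _ fun j _ => h2 j
  · ext x
    have hpos := (ratioProd_pos hM hN n x).ne'
    simp only [Set.mem_ofPred_eq, Set.mem_preimage]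
    rw [← tendsto_add_atTop_iff_nat n]
    simp only [add_comm _ n, ratioProd_add M N n]
    constructor
    · intro h
      simpa [← mul_assoc, inv_mul_cancel₀ hpos] using h.const_mul (ratioProd M N n x)⁻¹
    · intro h
      simpa using h.const_mul (ratioProd M N n x)

/-- A sequence which begins with the word `w`; past its end the word is repeated. -/
def extendWord {n : ℕ} (w : Fin (n + 1) → Fin 2) : ℕ → Fin 2 := fun i => w (Fin.ofNat (n + 1) i)

theorem extendWord_apply {n : ℕ} (w : Fin (n + 1) → Fin 2) (i : Fin (n + 1)) :
    extendWord w i = w i :=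
  congrArg w (Fin.ofNat_val_eq_self i)

/-- The integral of a function of the coordinates `0, …, n` is a sum over words. -/
theorem integral_eq_sum_word (M : MarkovPair) {n : ℕ} {f : (ℕ → Fin 2) → ℝ}
    (hf : ∀ x, ∀ y ∈ wordCylinder n x, f y = f x) :
    Integrable f M.measure ∧ ∫ x, f x ∂M.measure =
      ∑ w : Fin (n + 1) → Fin 2, M.cylinderMass n (extendWord w) * f (extendWord w) := by
  set T : (ℕ → Fin 2) → (Fin (n + 1) → Fin 2) := fun x i => x i with hT
  have hTm : Measurable T := measurable_pi_lambda _ fun i => measurable_pi_apply _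
  have hcyl : ∀ w, T ⁻¹' {w} = wordCylinder n (extendWord w) := by
    intro w
    ext x
    simp only [Set.mem_preimage, Set.mem_singleton_iff, hT, funext_iff]
    exact ⟨fun h i hi => (h ⟨i, by omega⟩).trans (extendWord_apply w ⟨i, by omega⟩).symm,
      fun h i => (h i (by omega)).trans (extendWord_apply w i)⟩
  have hfac : f = fun x => f (extendWord (T x)) := by
    funext x
    exact hf _ _ (by rw [← hcyl]; rfl)
  have := Measure.isProbabilityMeasure_map (μ := M.measure) hTm.aemeasurable
  have hint : Integrable (fun w => f (extendWord w)) (M.measure.map T) := Integrable.of_finite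
  constructor
  · rw [hfac]
    exact hint.comp_measurable hTm
  · conv_lhs => rw [hfac]
    rw [← integral_map (f := fun w => f (extendWord w)) hTm.aemeasurable hint.1,
      integral_fintype hint]
    refine Finset.sum_congr rfl fun w _ => ?_
    rw [map_measureReal_apply hTm (MeasurableSet.singleton w), hcyl, measureReal_wordCylinder,
      smul_eq_mul]

theorem integral_sqrt_ratioProd {M : MarkovPair} (hM : M.NonDegenerate) (N : MarkovPair) (n : ℕ) :
    Integrable (fun x => √(ratioProd M N n x)) M.measure ∧
      ∫ x, √(ratioProd M N n x) ∂M.measure = hellingerSum M N n := by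
  have hsum := M.integral_eq_sum_word (n := n) (f := fun x => √(ratioProd M N n x))
    fun x y h => by rw [ratioProd_congr M N h]
  refine ⟨hsum.1, hsum.2.trans ?_⟩
  rw [hellingerSum]
  refine Finset.sum_congr rfl fun w _ => ?_
  set x := extendWord w with hx
  have hp := hM.cylinderMass_pos n x
  have hsq : M.cylinderMass n x * √(ratioProd M N n x) =
      √(N.cylinderMass n x * M.cylinderMass n x) := by
    have h1 : N.cylinderMass n x * M.cylinderMass n x =
        M.cylinderMass n x ^ 2 * ratioProd M N n x := by
      rw [ratioProd_eq_div]
      field_simp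
    rw [h1, Real.sqrt_mul (sq_nonneg _), Real.sqrt_sq hp.le]
  have h0 : x 0 = w 0 := extendWord_apply w 0
  have h1 : ∀ i : Fin n, x i = w i.castSucc := fun i => extendWord_apply w i.castSucc
  have h2 : ∀ i : Fin n, x (i + 1) = w i.succ := fun i => extendWord_apply w i.succ
  have h3 : N.cylinderMass n x * M.cylinderMass n x = N.init (w 0) * M.init (w 0) *
      ∏ i : Fin n, N.trans i (w i.castSucc) (w i.succ) * M.trans i (w i.castSucc) (w i.succ) := by
    rw [cylinderMass, cylinderMass, Finset.prod_range, Finset.prod_range, mul_mul_mul_comm,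
      ← Finset.prod_mul_distrib]
    simp only [h0, h1, h2]
  rw [hsq, h3, Real.sqrt_mul (mul_nonneg (N.init_mem.1 _) (M.init_mem.1 _)), Real.sqrt_prod]
  exact fun i _ => mul_nonneg ((N.trans_row_mem _ _).1 _) ((M.trans_row_mem _ _).1 _)

theorem integral_ratioProd {M : MarkovPair} (hM : M.NonDegenerate) (N : MarkovPair) (n : ℕ) :
    Integrable (ratioProd M N n) M.measure ∧ ∫ x, ratioProd M N n x ∂M.measure = 1 := by
  have hsum := M.integral_eq_sum_word (n := n) (f := ratioProd M N n)
    fun x y h => ratioProd_congr M N h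
  have hone := N.integral_eq_sum_word (n := n) (f := fun _ => (1 : ℝ)) fun _ _ _ => rfl
  refine ⟨hsum.1, hsum.2.trans ?_⟩
  have h1 := hone.2
  simp only [integral_const, probReal_univ, smul_eq_mul, mul_one] at h1
  rw [h1]
  refine Finset.sum_congr rfl fun w _ => ?_
  rw [ratioProd_eq_div, mul_div_cancel₀ _ (hM.cylinderMass_pos n _).ne']

theorem tendsto_integral_min_sqrt_ratioProd {M N : MarkovPair} {Z : (ℕ → Fin 2) → ℝ}
    (hZ : ∀ᵐ x ∂M.measure, Tendsto (fun n => ratioProd M N n x) atTop (𝓝 (Z x))) {K : ℝ}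
    (hK : 0 ≤ K) :
    Tendsto (fun n => ∫ x, min √(ratioProd M N n x) K ∂M.measure) atTop
      (𝓝 (∫ x, min √(Z x) K ∂M.measure)) := by
  refine tendsto_integral_of_dominated_convergence (fun _ => K)
    (fun n => ((measurable_ratioProd M N n).sqrt.min measurable_const).aestronglyMeasurable)
    (integrable_const K) (fun n => ae_of_all _ fun x => ?_) ?_
  · rw [Real.norm_of_nonneg (le_min (Real.sqrt_nonneg _) hK)]
    exact min_le_right _ _
  · filter_upwards [hZ] with x hx
    exact hx.sqrt.min tendsto_const_nhds

/-- The square roots of the likelihood ratios are bounded in `L²`, hence uniformly integrable, so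
the Hellinger sums tend to `0` with the likelihood ratios. The cut-off at height `K` costs at most
`1 / K`, because `t ≤ min t K + t² / K`. -/
theorem limit_hellingerSum_eq_zero {M N : MarkovPair} (hM : M.NonDegenerate) (hN : N.NonDegenerate)
    {L : ℝ} (hL : Tendsto (hellingerSum M N) atTop (𝓝 L))
    (h0 : ∀ᵐ x ∂M.measure, Tendsto (fun n => ratioProd M N n x) atTop (𝓝 0)) : L = 0 := by
  have hbound : ∀ K : ℝ, 0 < K → L ≤ K⁻¹ := by
    intro K hK
    have hlim := (tendsto_integral_min_sqrt_ratioProd (Z := fun _ => 0) h0 hK.le).add_const K⁻¹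
    simp only [Real.sqrt_zero, min_eq_left hK.le, integral_zero, zero_add] at hlim
    refine le_of_tendsto_of_tendsto' hL hlim fun n => ?_
    have hmin : Integrable (fun x => min √(ratioProd M N n x) K) M.measure :=
      (integral_sqrt_ratioProd hM N n).1.inf (integrable_const K)
    have hZ := (integral_ratioProd hM N n).1.mul_const K⁻¹
    calc hellingerSum M N n = ∫ x, √(ratioProd M N n x) ∂M.measure :=
          (integral_sqrt_ratioProd hM N n).2.symm
      _ ≤ ∫ x, (min √(ratioProd M N n x) K + ratioProd M N n x * K⁻¹) ∂M.measure := by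
          refine integral_mono (integral_sqrt_ratioProd hM N n).1 (hmin.add hZ) fun x => ?_
          have hr := (ratioProd_pos hM hN n x).le
          change √(ratioProd M N n x) ≤ min √(ratioProd M N n x) K + ratioProd M N n x * K⁻¹
          rcases le_total √(ratioProd M N n x) K with h | h
          · rw [min_eq_left h]
            exact le_add_of_nonneg_right (mul_nonneg hr (inv_nonneg.2 hK.le))
          · rw [min_eq_right h]
            refine le_add_of_nonneg_of_le hK.le ?_
            rw [← div_eq_mul_inv, le_div_iff₀ hK]
            nlinarith [Real.sq_sqrt hr]
      _ = ∫ x, min √(ratioProd M N n x) K ∂M.measure + K⁻¹ := by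
          rw [integral_add hmin hZ, integral_mul_const, (integral_ratioProd hM N n).2, one_mul]
  refine le_antisymm ?_ (ge_of_tendsto' hL (hellingerSum_nonneg M N))
  exact ge_of_tendsto tendsto_inv_atTop_zero ((eventually_gt_atTop 0).mono hbound)

theorem absolutelyContinuous_of_limit_ne_zero {M N : MarkovPair} (hM : M.NonDegenerate)
    (hN : N.NonDegenerate) (hMa : ∀ x, M.measure {x} = 0) {L : ℝ}
    (hL : Tendsto (hellingerSum M N) atTop (𝓝 L)) (hL0 : L ≠ 0) : M.measure ≪ N.measure := by
  refine absolutelyContinuous_of_not_tendsto hM hN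
    ((measure_tendsto_ratioProd_zero hM hN hMa).resolve_right fun h1 => hL0 ?_)
  refine limit_hellingerSum_eq_zero hM hN hL ?_
  exact (mem_ae_iff_prob_eq_one
    (measurableSet_tendsto _ fun n => measurable_ratioProd M N n)).2 h1

/-- If the measures are equivalent, the Hellinger sums stay above the integral of the positive
function `min √(dν/dμ) 1`. -/
theorem limit_hellingerSum_ne_zero_of_equiv {M N : MarkovPair} (hM : M.NonDegenerate)
    (hN : N.NonDegenerate) {L : ℝ} (hL : Tendsto (hellingerSum M N) atTop (𝓝 L))
    (h : EquivMeasures N.measure M.measure) : L ≠ 0 := by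
  set Z : (ℕ → Fin 2) → ℝ := fun x => (N.measure.rnDeriv M.measure x).toReal with hZ
  have hlim := tendsto_integral_min_sqrt_ratioProd (Z := Z)
    (tendsto_ratioProd_rnDeriv hM hN h.1) zero_le_one
  have hle : ∫ x, min √(Z x) 1 ∂M.measure ≤ L := by
    refine le_of_tendsto_of_tendsto' hlim hL fun n => ?_
    rw [← (integral_sqrt_ratioProd hM N n).2]
    exact integral_mono ((integral_sqrt_ratioProd hM N n).1.inf (integrable_const 1))
      (integral_sqrt_ratioProd hM N n).1 fun x => min_le_left _ _
  have hZm : Measurable Z := (Measure.measurable_rnDeriv _ _).ennreal_toReal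
  have hpos : ∀ᵐ x ∂M.measure, 0 < min √(Z x) 1 := by
    -- Instance search alone exceeds its size bound on a detour through the topology of `ℕ → Fin 2`.
    have := Measure.haveLebesgueDecomposition_of_sigmaFinite N.measure M.measure
    filter_upwards [Measure.rnDeriv_pos' h.2, Measure.rnDeriv_lt_top N.measure M.measure]
      with x h1 h2
    exact lt_min (Real.sqrt_pos.2 (ENNReal.toReal_pos h1.ne' h2.ne)) one_pos
  have hint : Integrable (fun x => min √(Z x) 1) M.measure :=
    Integrable.of_bound (hZm.sqrt.min measurable_const).aestronglyMeasurable 1 <|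
      ae_of_all _ fun x => by
        rw [Real.norm_of_nonneg (le_min (Real.sqrt_nonneg _) zero_le_one)]
        exact min_le_right _ _
  rintro rfl
  have hzero := (integral_eq_zero_iff_of_nonneg_ae (hpos.mono fun x hx => hx.le) hint).1
    (le_antisymm hle (integral_nonneg_of_ae (hpos.mono fun x hx => hx.le)))
  obtain ⟨x, hx, hx'⟩ := (hpos.and hzero).exists
  exact hx.ne' hx'

theorem equiv_iff_limit_ne_zero {M N : MarkovPair} (hM : M.NonDegenerate) (hN : N.NonDegenerate)
    (hMa : ∀ x, M.measure {x} = 0) (hNa : ∀ x, N.measure {x} = 0) {L : ℝ}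
    (hL : Tendsto (hellingerSum M N) atTop (𝓝 L)) :
    EquivMeasures N.measure M.measure ↔ L ≠ 0 := by
  refine ⟨limit_hellingerSum_ne_zero_of_equiv hM hN hL, fun h => ⟨?_, ?_⟩⟩
  · refine absolutelyContinuous_of_limit_ne_zero hN hM hNa (hL.congr fun n => ?_) h
    exact hellingerSum_comm M N n
  · exact absolutelyContinuous_of_limit_ne_zero hM hN hMa hL h

end MarkovPair

theorem corollary5p5 (M N : MarkovPair) (hM : M.NonDegenerate) (hN : N.NonDegenerate)
    (hMa : ∀ x, M.measure {x} = 0) (hNa : ∀ x, N.measure {x} = 0) :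
    (∃ L : ℝ, Tendsto (fun n => MarkovPair.hellingerSum M N n) atTop (𝓝 L) ∧
      (EquivMeasures N.measure M.measure ↔ L ≠ 0)) ∧
    (EquivMeasures N.measure M.measure →
      ∀ᵐ x ∂M.measure, Tendsto (fun n => MarkovPair.ratioProd M N n x) atTop
        (𝓝 (N.measure.rnDeriv M.measure x).toReal)) ∧
    (M.UniformlyPositive → N.UniformlyPositive →
      (EquivMeasures N.measure M.measure ↔
        ∀ i j, Summable fun n => (M.trans n i j - N.trans n i j) ^ 2)) := by
  obtain ⟨L, hL⟩ := MarkovPair.exists_tendsto_hellingerSum M N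
  have hiff := MarkovPair.equiv_iff_limit_ne_zero hM hN hMa hNa hL
  exact ⟨⟨L, hL, hiff⟩, fun h => MarkovPair.tendsto_ratioProd_rnDeriv hM hN h.1,
    fun hMu hNu => hiff.trans (MarkovPair.limit_hellingerSum_ne_zero_iff hM hN hMu hNu hL)⟩
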